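/- Let $m\ge 2$, let $a_0,\dots,a_m\in\mathbb{R}$ with $a_m\neq 0$, and let $k-1<\alpha_k\le k$ for $k=1,\dots,m$, where moreover $\alpha_{m-1}\neq m-1$. For $\alpha>0$ and $n=\lceil\alpha\rceil$ let ${}_0^C\mathrm{D}_t^{\alpha}f(t)=\frac{1}{\Gamma(n-\alpha)}\int_0^t(t-\tau)^{n-\alpha-1}f^{(n)}(\tau)\,\mathrm{d}\tau$ if $\alpha<n$, and ${}_0^C\mathrm{D}_t^{\alpha}f=f^{(n)}$ if $\alpha=n$, be the Caputo derivative, applied to real functions $f\in C^{n-1}[0,\infty)\cap C^n(0,\infty)$ with $f^{(n)}$ integrable on $(0,T]$ for every $T>0$. Consider, for $t>0$, the equation $$a_0x(t)+a_1\,{}_0^C\mathrm{D}_t^{\alpha_1}x(t)+\dots+a_m\,{}_0^C\mathrm{D}_t^{\alpha_m}x(t)=0,\qquad x^{(i)}(0)=C_i\quad(0\le i\le m-1),\tag{1}$$ and the system of $2m-2$ equations for $y_0=x,y_1,\dots,y_{2m-3}$, $${}_0^C\mathrm{D}_t^{\beta_j}y_j(t)=y_{j+1}(t)\quad(0\le j\le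 2m-4),\qquad {}_0^C\mathrm{D}_t^{\beta_{2m-3}}y_{2m-3}(t)=-\frac1{a_m}\Big[a_0y_0(t)+\sum_{i=1}^{m-1}a_iy_{2i-1}(t)\Big],\tag{2}$$ whose orders $\beta_0,\dots,\beta_{2m-3}>0$ satisfy $$\beta_0=\alpha_1,\qquad \alpha_i+\beta_{2i-1}+\beta_{2i}=\alpha_{i+1}\quad(1\le i\le m-2),\qquad \alpha_{m-1}+\beta_{2m-3}=\alpha_m.$$ Then (1) and (2) are not equivalent: it is not true that for all $C_0,\dots,C_{m-1}\in\mathbb{R}$ there are initial values $y_j^{(l)}(0)$, $0\le l<\lceil\beta_j\rceil$, for (2) such that the solutions $x$ of (1) on $[0,\infty)$ are exactly the components $y_0$ of the solutions of (2) with these initial values. More precisely, whenever $C_{m-1}\neq 0$, problem (1) has a solution on $[0,\infty)$, and no solution of (1) is the component $y_0$ of a solution of (2), for any initial values of (2) whatsoever. -/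

import Mathlib

namespace FracSplit

/-- The `n`-th derivative of `f : [0, ∞) → ℝ` (one-sided at `0`). Only the values of `f` on
`[0, ∞)` matter. -/
noncomputable def derivN (n : ℕ) (f : ℝ → ℝ) (t : ℝ) : ℝ :=
  iteratedDerivWithin n f (Set.Ici 0) t

/-- The Caputo derivative with base point `0` of order `α > 0`. With `n = ⌈α⌉`, it is the classical
derivative `f⁽ⁿ⁾ t` if `α = n`, and otherwise
`1 / Γ(n - α) * ∫₀ᵗ (t - τ) ^ (n - α - 1) * f⁽ⁿ⁾ τ dτ`. -/
noncomputable def caputo (α : ℝ) (f : ℝ → ℝ) (t : ℝ) : ℝ :=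
  if α = (⌈α⌉₊ : ℝ) then derivN ⌈α⌉₊ f t
  else (Real.Gamma ((⌈α⌉₊ : ℝ) - α))⁻¹ *
    ∫ τ in (0 : ℝ)..t, (t - τ) ^ ((⌈α⌉₊ : ℝ) - α - 1) * derivN ⌈α⌉₊ f τ

/-- The functions on `[0, ∞)` to which the Caputo derivative of order `α > 0` is applied. With
`n = ⌈α⌉`, these are the `f` in `Cⁿ⁻¹[0, ∞) ∩ Cⁿ(0, ∞)` whose `n`-th derivative is integrable on
every bounded interval `(0, T]`. Then the integral defining `caputo α f t` converges for every
`t > 0`. The `n`-th derivative may be singular at `0`, as it is for solutions of fractional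
equations. -/
structure Admissible (α : ℝ) (f : ℝ → ℝ) : Prop where
  contDiffOn_Ici : ContDiffOn ℝ ((⌈α⌉₊ - 1 : ℕ) : WithTop ℕ∞) f (Set.Ici 0)
  contDiffOn_Ioi : ContDiffOn ℝ ((⌈α⌉₊ : ℕ) : WithTop ℕ∞) f (Set.Ioi 0)
  integrableOn : ∀ T : ℝ, 0 < T →
    MeasureTheory.IntegrableOn (derivN ⌈α⌉₊ f) (Set.Ioc 0 T)

/-- `x` solves `a₀ x + a₁ D^{α₁} x + ⋯ + a_m D^{α_m} x = 0` on `t > 0`, with initial values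
`x⁽ⁱ⁾(0) = C i` for `i < m`. -/
structure SolvesEquation (m : ℕ) (a α C : ℕ → ℝ) (x : ℝ → ℝ) : Prop where
  admissible : ∀ k ∈ Finset.Icc 1 m, Admissible (α k) x
  equation : ∀ t : ℝ, 0 < t →
    a 0 * x t + ∑ k ∈ Finset.Icc 1 m, a k * caputo (α k) x t = 0
  initial : ∀ i < m, derivN i x 0 = C i

/-- `y 0, …, y (2m - 3)` solve, on `t > 0`, the system of `2m - 2` equations
`D^{β_j} y_j = y_{j+1}` for `0 ≤ j ≤ 2m - 4` and
`D^{β_{2m-3}} y_{2m-3} = -(a₀ y₀ + a₁ y₁ + a₂ y₃ + ⋯ + a_{m-1} y_{2m-3}) / a_m`. -/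
structure SolvesSystem (m : ℕ) (a β : ℕ → ℝ) (y : ℕ → ℝ → ℝ) : Prop where
  admissible : ∀ j < 2 * m - 2, Admissible (β j) (y j)
  chain : ∀ j < 2 * m - 3, ∀ t : ℝ, 0 < t → caputo (β j) (y j) t = y (j + 1) t
  last : ∀ t : ℝ, 0 < t → caputo (β (2 * m - 3)) (y (2 * m - 3)) t =
    -1 / a m * (a 0 * y 0 t + ∑ i ∈ Finset.Icc 1 (m - 1), a i * y (2 * i - 1) t)

/-- The initial conditions of the system: `y_j⁽ˡ⁾(0) = D j l` for `l < ⌈β_j⌉`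
(only `y_j(0) = D j 0` if `β_j ≤ 1`). -/
def SystemInitial (m : ℕ) (β : ℕ → ℝ) (D : ℕ → ℕ → ℝ) (y : ℕ → ℝ → ℝ) : Prop :=
  ∀ j < 2 * m - 2, ∀ l < ⌈β j⌉₊, derivN l (y j) 0 = D j l

/-- The equation and the system are equivalent: for all initial values `C` of the equation there are
initial values `D` of the system such that the solutions of the initial value problem for the
equation are exactly the components `y₀` of the solutions of the initial value problem for the
system. -/
def Equivalent (m : ℕ) (a α β : ℕ → ℝ) : Prop :=
  ∀ C : ℕ → ℝ, ∃ D : ℕ → ℕ → ℝ, ∀ x : ℝ → ℝ,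
    SolvesEquation m a α C x ↔
      ∃ y : ℕ → ℝ → ℝ, SolvesSystem m a β y ∧ SystemInitial m β D y ∧ Set.EqOn x (y 0) (Set.Ici 0)

end FracSplit

/-!
The obstruction is an asymptotic one at `t = 0`. In a solution of the system every component is, by
inversion of its Caputo derivative, a Taylor polynomial of degree less than `⌈β_j⌉` plus the
fractional integral of order `β_j` of the next component
(`Admissible.eq_taylor_add_fracInt_caputo`). Substituting these identities into each other, with the
semigroup law `fracInt_fracInt`, writes `y₀` as a combination of the powers `t ^ (γ_j + l)`,
`l < β_j`, `γ_j = β_0 + ⋯ + β_{j-1}`, plus the integral of order `α_m > m - 1` of a function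
continuous at `0`, which is `O(t ^ α_m)`. None of the exponents is `m - 1`: those with `j < 2m - 3`
are smaller than `γ_{2m-3} = α_{m-1} < m - 1`, and the others differ from `α_{m-1}`, which lies
strictly between `m - 2` and `m - 1`, by an integer. But `y₀ = x` is `m - 1` times continuously
differentiable at `0`, so its Taylor expansion has the term `C_{m-1} t ^ (m - 1) / (m - 1)!`. As
expansions in powers are unique (`eq_zero_of_sum_rpow_isLittleO`), `C_{m-1} = 0`; this is
`SolvesSystem.derivN_eq_zero`.

That the equation has a solution for all initial values is `exists_solvesEquation`. The derivative
`z` of order `m` has to satisfy a Volterra equation `z + ∑ bᵢ I^{εᵢ} z = h`, whose right-hand side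
is a combination of powers with exponents greater than `-1`. Powers with positive exponents are handled
by the contraction principle in an exponentially weighted space of continuous functions
(`volterraSolvable_rpow_of_pos`), the remaining ones are reduced to these by finitely many steps of
successive approximation (`volterraSolvable_rpow`).
-/

namespace FracSplit

open MeasureTheory Set Filter Topology

/-! ### Riemann–Liouville integrals -/

/-- The functions on the open half-line `(0, ∞)` on which fractional integration with base point `0`
is well behaved: continuous on `(0, ∞)` and integrable up to `0`. They may be singular at `0`. -/
structure IsRegular (f : ℝ → ℝ) : Prop where
  continuousOn : ContinuousOn f (Ioi 0)
  intervalIntegrable : ∀ t : ℝ, 0 < t → IntervalIntegrable f volume 0 t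

/-- The Riemann–Liouville integral of order `a ≥ 0` with base point `0`. Order `0` is
defined separately, as the identity: the general formula has the junk value `0` there. -/
noncomputable def fracInt (a : ℝ) (f : ℝ → ℝ) (t : ℝ) : ℝ :=
  if a = 0 then f t else (Real.Gamma a)⁻¹ * ∫ τ in (0 : ℝ)..t, (t - τ) ^ (a - 1) * f τ

/-- The normalized power function `t ^ e / Γ(e + 1)`, so that `fracInt a (powFn e) = powFn (e + a)`
on `(0, ∞)`. -/
noncomputable def powFn (e t : ℝ) : ℝ := t ^ e / Real.Gamma (e + 1)

lemma IsRegular.add {f g : ℝ → ℝ} (hf : IsRegular f) (hg : IsRegular g) :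
    IsRegular (fun t => f t + g t) :=
  ⟨hf.1.add hg.1, fun t ht => (hf.2 t ht).add (hg.2 t ht)⟩

lemma IsRegular.const_mul {f : ℝ → ℝ} (hf : IsRegular f) (c : ℝ) :
    IsRegular (fun t => c * f t) :=
  ⟨hf.1.const_smul c, fun t ht => (hf.2 t ht).const_mul c⟩

lemma IsRegular.sum {ι : Type*} (s : Finset ι) {f : ι → ℝ → ℝ} (hf : ∀ i ∈ s, IsRegular (f i)) :
    IsRegular (fun t => ∑ i ∈ s, f i t) := by
  refine ⟨continuousOn_finsetSum _ fun i hi => (hf i hi).1, fun t ht => ?_⟩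
  simpa only [Finset.sum_fn] using IntervalIntegrable.sum s fun i hi => (hf i hi).2 t ht

lemma isRegular_of_continuousOn {f : ℝ → ℝ} (hf : ContinuousOn f (Ici 0)) : IsRegular f :=
  ⟨hf.mono Ioi_subset_Ici_self, fun t ht =>
    (hf.mono (by rw [uIcc_of_le ht.le]; exact Icc_subset_Ici_self)).intervalIntegrable⟩

lemma isRegular_rpow {e : ℝ} (he : -1 < e) : IsRegular (fun t => t ^ e) :=
  ⟨fun _ ht => (Real.continuousAt_rpow_const _ _ (Or.inl (ne_of_gt ht))).continuousWithinAt,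
    fun _ _ => intervalIntegral.intervalIntegrable_rpow' he⟩

lemma isRegular_powFn {e : ℝ} (he : -1 < e) : IsRegular (powFn e) := by
  have := (isRegular_rpow he).const_mul (Real.Gamma (e + 1))⁻¹
  convert this using 2 with t
  rw [powFn, div_eq_inv_mul]

/-- The kernel may be multiplied on: near `0` the kernel is continuous, near `t` the function is. -/
lemma IsRegular.intervalIntegrable_kernel {f : ℝ → ℝ} (hf : IsRegular f) {a t : ℝ} (ha : 0 < a)
    (ht : 0 < t) : IntervalIntegrable (fun τ => (t - τ) ^ (a - 1) * f τ) volume 0 t := by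
  have h2 : 0 < t / 2 := by positivity
  have h1 : IntervalIntegrable (fun τ => (t - τ) ^ (a - 1) * f τ) volume 0 (t / 2) := by
    refine (hf.2 _ h2).continuousOn_mul fun x hx => ContinuousAt.continuousWithinAt ?_
    rw [uIcc_of_le h2.le] at hx
    exact ContinuousAt.rpow_const (by fun_prop) (Or.inl (by linarith [hx.2]))
  refine h1.trans ?_
  have h3 : IntervalIntegrable (fun τ => (t - τ) ^ (a - 1)) volume (t / 2) t := by
    have := (intervalIntegral.intervalIntegrable_rpow' (a := t / 2) (b := 0)
      (by linarith : -1 < a - 1)).comp_sub_left t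
    convert! this using 1 <;> ring
  refine h3.mul_continuousOn (hf.1.mono ?_)
  rw [uIcc_of_le (by linarith)]
  exact fun x hx => lt_of_lt_of_le h2 hx.1

lemma integral_beta {u v t : ℝ} (hu : 0 < u) (hv : 0 < v) (ht : 0 < t) :
    ∫ x in (0 : ℝ)..t, (t - x) ^ (u - 1) * x ^ (v - 1) =
      t ^ (u + v - 1) * (Real.Gamma u * Real.Gamma v / Real.Gamma (u + v)) := by
  have h := Complex.betaIntegral_scaled (v : ℂ) (u : ℂ) ht
  rw [Complex.betaIntegral_eq_Gamma_mul_div _ _ (by simpa) (by simpa)] at h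
  have h' : ((∫ x in (0 : ℝ)..t, (t - x) ^ (u - 1) * x ^ (v - 1) : ℝ) : ℂ) =
      ∫ x in (0 : ℝ)..t, (x : ℂ) ^ ((v : ℂ) - 1) * ((t : ℂ) - x) ^ ((u : ℂ) - 1) := by
    rw [← intervalIntegral.integral_ofReal]
    refine intervalIntegral.integral_congr fun x hx => ?_
    rw [uIcc_of_le ht.le] at hx
    rw [Complex.ofReal_mul, Complex.ofReal_cpow (by linarith [hx.2]), Complex.ofReal_cpow hx.1]
    push_cast
    ring
  rw [h] at h'
  have h4 : (t : ℂ) ^ ((v : ℂ) + u - 1) = ((t ^ (u + v - 1) : ℝ) : ℂ) := by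
    rw [Complex.ofReal_cpow ht.le]; push_cast; ring_nf
  rw [h4, Complex.Gamma_ofReal, Complex.Gamma_ofReal, ← Complex.ofReal_add,
    Complex.Gamma_ofReal] at h'
  rw [add_comm v u] at h'
  have h5 := h'.trans (b := _) (c := ((t ^ (u + v - 1) *
    (Real.Gamma u * Real.Gamma v / Real.Gamma (u + v)) : ℝ) : ℂ)) (by push_cast; ring)
  exact_mod_cast h5

lemma fracInt_zero (f : ℝ → ℝ) : fracInt 0 f = f := by
  ext t; simp [fracInt]

lemma fracInt_of_pos {a : ℝ} (ha : 0 < a) (f : ℝ → ℝ) (t : ℝ) :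
    fracInt a f t = (Real.Gamma a)⁻¹ * ∫ τ in (0 : ℝ)..t, (t - τ) ^ (a - 1) * f τ := by
  simp [fracInt, ha.ne']

lemma fracInt_one (f : ℝ → ℝ) (t : ℝ) : fracInt 1 f t = ∫ τ in (0 : ℝ)..t, f τ := by
  simp [fracInt]

lemma fracInt_congr {a t : ℝ} (ht : 0 < t) {f g : ℝ → ℝ} (h : EqOn f g (Ioi 0)) :
    fracInt a f t = fracInt a g t := by
  unfold fracInt
  split_ifs
  · exact h ht
  · congr 1
    rw [intervalIntegral.integral_of_le ht.le, intervalIntegral.integral_of_le ht.le]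
    exact setIntegral_congr_fun measurableSet_Ioc fun x hx => by simp only [h hx.1]

lemma fracInt_const_mul (a c : ℝ) (f : ℝ → ℝ) (t : ℝ) :
    fracInt a (fun s => c * f s) t = c * fracInt a f t := by
  unfold fracInt
  split_ifs
  · rfl
  · simp only [mul_left_comm _ c, intervalIntegral.integral_const_mul]

/-- Integrability on `[0, t]` of the integrand in the fractional integral of order `a` of `f` at `t`
(no condition if `a = 0`). -/
def KernelIntegrable (a t : ℝ) (f : ℝ → ℝ) : Prop :=
  0 < a → IntervalIntegrable (fun τ => (t - τ) ^ (a - 1) * f τ) volume 0 t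

lemma IsRegular.kernelIntegrable {f : ℝ → ℝ} (hf : IsRegular f) (a : ℝ) {t : ℝ} (ht : 0 < t) :
    KernelIntegrable a t f := fun ha => hf.intervalIntegrable_kernel ha ht

lemma KernelIntegrable.const_mul {a t : ℝ} {f : ℝ → ℝ} (hf : KernelIntegrable a t f) (c : ℝ) :
    KernelIntegrable a t (fun s => c * f s) := fun ha => by
  simpa only [mul_left_comm] using (hf ha).const_mul c

lemma KernelIntegrable.sum {ι : Type*} {a t : ℝ} (s : Finset ι) {f : ι → ℝ → ℝ}
    (hf : ∀ i ∈ s, KernelIntegrable a t (f i)) :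
    KernelIntegrable a t (fun x => ∑ i ∈ s, f i x) := fun ha => by
  simpa only [Finset.sum_fn, Finset.mul_sum] using IntervalIntegrable.sum s fun i hi => hf i hi ha

lemma fracInt_add {a t : ℝ} (ha : 0 ≤ a) {f g : ℝ → ℝ} (hf : KernelIntegrable a t f)
    (hg : KernelIntegrable a t g) :
    fracInt a (fun s => f s + g s) t = fracInt a f t + fracInt a g t := by
  rcases ha.eq_or_lt with rfl | ha
  · simp [fracInt_zero]
  · simp only [fracInt_of_pos ha, mul_add]
    rw [intervalIntegral.integral_add (hf ha) (hg ha), mul_add]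

lemma fracInt_sum {ι : Type*} {a t : ℝ} (ha : 0 ≤ a) (s : Finset ι) {f : ι → ℝ → ℝ}
    (hf : ∀ i ∈ s, KernelIntegrable a t (f i)) :
    fracInt a (fun x => ∑ i ∈ s, f i x) t = ∑ i ∈ s, fracInt a (f i) t := by
  rcases ha.eq_or_lt with rfl | ha
  · simp [fracInt_zero]
  · simp only [fracInt_of_pos ha, Finset.mul_sum]
    rw [intervalIntegral.integral_finsetSum fun i hi => hf i hi ha, Finset.mul_sum]

lemma fracInt_powFn {a e t : ℝ} (ha : 0 ≤ a) (he : -1 < e) (ht : 0 < t) :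
    fracInt a (powFn e) t = powFn (e + a) t := by
  rcases ha.eq_or_lt with rfl | ha
  · simp [fracInt_zero]
  · have h := integral_beta ha (by linarith : 0 < e + 1) ht
    simp only [add_sub_cancel_right] at h
    simp only [fracInt_of_pos ha, powFn, ← mul_div_assoc, intervalIntegral.integral_div, h]
    have h1 := (Real.Gamma_pos_of_pos ha).ne'
    have h2 := (Real.Gamma_pos_of_pos (by linarith : 0 < e + 1)).ne'
    rw [show a + (e + 1) - 1 = e + a by ring, show a + (e + 1) = e + a + 1 by ring]
    field_simp

/-- Fubini's theorem for iterated fractional integrals. -/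
lemma integral_kernel_comp {f : ℝ → ℝ} (hf : IsRegular f) {a b t : ℝ} (ha : 0 < a) (hb : 0 < b)
    (ht : 0 < t) :
    IntervalIntegrable (fun s => (t - s) ^ (a - 1) * ∫ τ in (0 : ℝ)..s, (s - τ) ^ (b - 1) * f τ)
      volume 0 t ∧
    ∫ s in (0 : ℝ)..t, (t - s) ^ (a - 1) * ∫ τ in (0 : ℝ)..s, (s - τ) ^ (b - 1) * f τ =
      Real.Gamma a * Real.Gamma b / Real.Gamma (a + b) *
        ∫ τ in (0 : ℝ)..t, (t - τ) ^ (a + b - 1) * f τ := by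
  set μ := (volume : Measure ℝ).restrict (Ioc 0 t) with hμ
  set k : ℝ × ℝ → ℝ := {p : ℝ × ℝ | p.2 < p.1}.indicator
    (fun p => (t - p.1) ^ (a - 1) * (p.1 - p.2) ^ (b - 1)) with hk
  set G : ℝ × ℝ → ℝ := fun p => k p * f p.2 with hG
  set B := Real.Gamma a * Real.Gamma b / Real.Gamma (a + b) with hB
  have hkm : Measurable k := by
    refine Measurable.indicator (by fun_prop) ?_
    exact measurableSet_lt measurable_snd measurable_fst
  have hfm : AEStronglyMeasurable f μ :=
    (hf.1.mono Ioc_subset_Ioi_self).aestronglyMeasurable measurableSet_Ioc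
  have hGm : AEStronglyMeasurable G (μ.prod μ) :=
    hkm.aestronglyMeasurable.mul hfm.comp_snd
  have hkval : ∀ s τ, k (s, τ) = (Ioi τ).indicator
      (fun s => (t - s) ^ (a - 1) * (s - τ) ^ (b - 1)) s := fun s τ => by
    simp [hk, indicator_apply]
  have hkval' : ∀ s τ, k (s, τ) * f τ = (Iio s).indicator
      (fun τ => (t - s) ^ (a - 1) * ((s - τ) ^ (b - 1) * f τ)) τ := fun s τ => by
    simp only [hk, indicator_apply, mem_ofPred_eq, mem_Iio]
    split_ifs <;> ring
  -- the inner integral in `s`, for fixed `τ`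
  have hin : ∀ τ ∈ Ioo 0 t, Integrable (fun s => k (s, τ)) μ ∧
      ∫ s, k (s, τ) ∂μ = (t - τ) ^ (a + b - 1) * B := by
    intro τ hτ
    have hset : Ioi τ ∩ Ioc 0 t = Ioc τ t := by
      ext x; simp only [mem_inter_iff, mem_Ioi, mem_Ioc]
      exact ⟨fun h => ⟨h.1, h.2.2⟩, fun h => ⟨h.1, hτ.1.trans h.1, h.2⟩⟩
    have hpos : 0 < t - τ := sub_pos.2 hτ.2
    have hI : IntervalIntegrable (fun s => (t - s) ^ (a - 1) * (s - τ) ^ (b - 1)) volume τ t := by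
      have := ((isRegular_rpow (by linarith : -1 < b - 1)).intervalIntegrable_kernel ha
        hpos).comp_sub_right τ
      convert! this using 1
      · ext s; congr 2; ring
      · ring
      · ring
    have hval : ∫ s in τ..t, (t - s) ^ (a - 1) * (s - τ) ^ (b - 1) =
        (t - τ) ^ (a + b - 1) * B := by
      rw [hB, ← integral_beta ha hb hpos]
      have := intervalIntegral.integral_comp_sub_right (a := τ) (b := t)
        (fun x => (t - τ - x) ^ (a - 1) * x ^ (b - 1)) τ
      rw [sub_self] at this
      rw [← this]
      congr 1; ext s; congr 2; ring
    simp only [hkval]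
    constructor
    · rw [integrable_indicator_iff measurableSet_Ioi, IntegrableOn, hμ,
        Measure.restrict_restrict measurableSet_Ioi, hset]
      exact (intervalIntegrable_iff_integrableOn_Ioc_of_le hτ.2.le).1 hI
    · rw [integral_indicator measurableSet_Ioi, hμ, Measure.restrict_restrict measurableSet_Ioi,
        hset, ← intervalIntegral.integral_of_le hτ.2.le, hval]
  have hae : ∀ᵐ τ ∂μ, τ ∈ Ioo 0 t := by
    rw [hμ, ← Measure.restrict_congr_set (Ioo_ae_eq_Ioc (μ := volume) (a := (0 : ℝ)) (b := t))]
    exact ae_restrict_mem measurableSet_Ioo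
  have hnonneg : ∀ τ, ∀ᵐ s ∂μ, 0 ≤ k (s, τ) := by
    intro τ
    filter_upwards [hae] with s hs
    rw [hkval]
    exact indicator_apply_nonneg fun hx => mul_nonneg
      (Real.rpow_nonneg (sub_pos.2 hs.2).le _) (Real.rpow_nonneg (sub_pos.2 hx).le _)
  have hGint : Integrable G (μ.prod μ) := by
    refine (integrable_prod_iff' hGm).2 ⟨?_, ?_⟩
    · filter_upwards [hae] with τ hτ using (hin τ hτ).1.mul_const (f τ)
    · have h1 : Integrable (fun τ => B * ‖(t - τ) ^ (a + b - 1) * f τ‖) μ :=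
        ((intervalIntegrable_iff_integrableOn_Ioc_of_le ht.le).1
          (hf.intervalIntegrable_kernel (add_pos ha hb) ht)).norm.const_mul B
      refine h1.congr ?_
      filter_upwards [hae] with τ hτ
      have h2 : ∫ s, ‖G (s, τ)‖ ∂μ = ∫ s, k (s, τ) * ‖f τ‖ ∂μ := by
        refine integral_congr_ae ?_
        filter_upwards [hnonneg τ] with s hs
        rw [norm_mul, Real.norm_of_nonneg hs]
      rw [h2, integral_mul_const, (hin τ hτ).2, norm_mul,
        Real.norm_of_nonneg (Real.rpow_nonneg (sub_pos.2 hτ.2).le _)]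
      ring
  have hleft : ∀ᵐ s ∂μ, ∫ τ, G (s, τ) ∂μ =
      (t - s) ^ (a - 1) * ∫ τ in (0 : ℝ)..s, (s - τ) ^ (b - 1) * f τ := by
    filter_upwards [hae] with s hs
    have hset : Iio s ∩ Ioc 0 t = Ioo 0 s := by
      ext x; simp only [mem_inter_iff, mem_Iio, mem_Ioc, mem_Ioo]
      exact ⟨fun h => ⟨h.2.1, h.1⟩, fun h => ⟨h.2, h.1, (h.2.trans hs.2).le⟩⟩
    simp only [hG, hkval']
    rw [integral_indicator measurableSet_Iio, hμ, Measure.restrict_restrict measurableSet_Iio,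
      hset, integral_const_mul, intervalIntegral.integral_of_le hs.1.le,
      integral_Ioc_eq_integral_Ioo]
  constructor
  · rw [intervalIntegrable_iff_integrableOn_Ioc_of_le ht.le]
    exact hGint.integral_prod_left.congr hleft
  · rw [intervalIntegral.integral_of_le ht.le, ← integral_congr_ae hleft,
      integral_integral_swap hGint, intervalIntegral.integral_of_le ht.le, ← integral_const_mul]
    refine integral_congr_ae ?_
    filter_upwards [hae] with τ hτ
    simp only [hG]
    rw [integral_mul_const, (hin τ hτ).2]
    ring

lemma IsRegular.kernelIntegrable_fracInt {f : ℝ → ℝ} (hf : IsRegular f) (a : ℝ) {b t : ℝ}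
    (hb : 0 ≤ b) (ht : 0 < t) : KernelIntegrable a t (fracInt b f) := by
  rcases hb.eq_or_lt with rfl | hb
  · rw [fracInt_zero]; exact hf.kernelIntegrable a ht
  · intro ha
    have h := (integral_kernel_comp hf ha hb ht).1.const_mul (Real.Gamma b)⁻¹
    simpa only [mul_left_comm, ← fracInt_of_pos hb] using h

/-- The semigroup law for Riemann–Liouville integrals. -/
lemma fracInt_fracInt {f : ℝ → ℝ} (hf : IsRegular f) {a b t : ℝ} (ha : 0 ≤ a) (hb : 0 ≤ b)
    (ht : 0 < t) : fracInt a (fracInt b f) t = fracInt (a + b) f t := by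
  rcases ha.eq_or_lt with rfl | ha
  · rw [fracInt_zero, zero_add]
  rcases hb.eq_or_lt with rfl | hb
  · rw [fracInt_zero, add_zero]
  have h := (integral_kernel_comp hf ha hb ht).2
  have h1 := (Real.Gamma_pos_of_pos ha).ne'
  have h2 := (Real.Gamma_pos_of_pos hb).ne'
  have h3 : ∀ s, (t - s) ^ (a - 1) * fracInt b f s = (Real.Gamma b)⁻¹ *
      ((t - s) ^ (a - 1) * ∫ τ in (0 : ℝ)..s, (s - τ) ^ (b - 1) * f τ) := fun s => by
    rw [fracInt_of_pos hb, mul_left_comm]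
  rw [fracInt_of_pos ha, fracInt_of_pos (add_pos ha hb)]
  simp only [h3]
  rw [intervalIntegral.integral_const_mul, h]
  field_simp

/-! ### Inversion of the Caputo derivative -/

lemma derivN_zero (f : ℝ → ℝ) : derivN 0 f = f := by
  ext t; simp [derivN]

lemma derivN_succ (n : ℕ) (f : ℝ → ℝ) (t : ℝ) :
    derivN (n + 1) f t = derivWithin (derivN n f) (Ici 0) t := by
  unfold derivN; rw [iteratedDerivWithin_succ]

lemma iteratedDerivWithin_Ioi_eq_derivN (n : ℕ) (f : ℝ → ℝ) {t : ℝ} (ht : 0 < t) :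
    iteratedDerivWithin n f (Ioi 0) t = derivN n f t := by
  unfold derivN
  rw [iteratedDerivWithin_eq_iteratedFDerivWithin, iteratedDerivWithin_eq_iteratedFDerivWithin,
    iteratedFDerivWithin_congr_set]
  filter_upwards [Ioi_mem_nhds ht] with x hx
  exact propext ⟨fun _ => le_of_lt hx, fun _ => hx⟩

lemma continuousOn_derivN_Ici {n k : ℕ} {f : ℝ → ℝ} (hf : ContDiffOn ℝ (n : WithTop ℕ∞) f (Ici 0))
    (hk : k ≤ n) : ContinuousOn (derivN k f) (Ici 0) :=
  hf.continuousOn_iteratedDerivWithin (by exact_mod_cast hk) (uniqueDiffOn_Ici 0)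

lemma continuousOn_derivN_Ioi {n k : ℕ} {f : ℝ → ℝ} (hf : ContDiffOn ℝ (n : WithTop ℕ∞) f (Ioi 0))
    (hk : k ≤ n) : ContinuousOn (derivN k f) (Ioi 0) :=
  (hf.continuousOn_iteratedDerivWithin (by exact_mod_cast hk) (uniqueDiffOn_Ioi 0)).congr
    fun _ ht => (iteratedDerivWithin_Ioi_eq_derivN k f ht).symm

lemma hasDerivAt_derivN {n k : ℕ} {f : ℝ → ℝ} (hf : ContDiffOn ℝ (n : WithTop ℕ∞) f (Ioi 0))
    (hk : k < n) {t : ℝ} (ht : 0 < t) : HasDerivAt (derivN k f) (derivN (k + 1) f t) t := by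
  have h := (hf.differentiableOn_iteratedDerivWithin (by exact_mod_cast hk)
    (uniqueDiffOn_Ioi 0)).congr fun _ ht => (iteratedDerivWithin_Ioi_eq_derivN k f ht).symm
  have h1 := (h.differentiableAt (Ioi_mem_nhds ht)).hasDerivAt
  rwa [derivN_succ, derivWithin_of_mem_nhds (Ici_mem_nhds ht)]

lemma caputo_eq_fracInt (α : ℝ) (f : ℝ → ℝ) (t : ℝ) :
    caputo α f t = fracInt ((⌈α⌉₊ : ℝ) - α) (derivN ⌈α⌉₊ f) t := by
  unfold caputo fracInt
  by_cases h : α = (⌈α⌉₊ : ℝ)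
  · rw [if_pos h, if_pos (by linarith)]
  · rw [if_neg h, if_neg fun h' => h (by linarith)]

/-- If `y i` is a polynomial plus the fractional integral of order `b i` of `y (i + 1)`, then `y 0`
is a sum of powers plus the fractional integral of order `b 0 + ⋯ + b (N - 1)` of `y N`. -/
lemma eq_sum_powFn_add_fracInt {N : ℕ} {n : ℕ → ℕ} {D : ℕ → ℕ → ℝ} {b : ℕ → ℝ} {y : ℕ → ℝ → ℝ}
    (hb : ∀ i < N, 0 ≤ b i) (hy : ∀ i ≤ N, IsRegular (y i))
    (h : ∀ i < N, ∀ t, 0 < t →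
      y i t = ∑ l ∈ Finset.range (n i), D i l * powFn l t + fracInt (b i) (y (i + 1)) t) :
    ∀ t, 0 < t → y 0 t = ∑ i ∈ Finset.range N, ∑ l ∈ Finset.range (n i),
      D i l * powFn (∑ j ∈ Finset.range i, b j + l) t +
        fracInt (∑ j ∈ Finset.range N, b j) (y N) t := by
  induction N with
  | zero => intro t ht; simp [fracInt_zero]
  | succ N ih =>
    intro t ht
    have hbN : 0 ≤ ∑ j ∈ Finset.range N, b j :=
      Finset.sum_nonneg fun i hi => hb i ((Finset.mem_range.1 hi).trans N.lt_succ_self)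
    have hneg : ∀ l : ℕ, (-1 : ℝ) < l := fun l => by linarith [(Nat.cast_nonneg l : (0 : ℝ) ≤ l)]
    have hP : ∀ l ∈ Finset.range (n N), KernelIntegrable (∑ j ∈ Finset.range N, b j) t
        (fun s => D N l * powFn l s) := fun l _ =>
      ((isRegular_powFn (hneg l)).const_mul _).kernelIntegrable _ ht
    rw [ih (fun i hi => hb i (hi.trans N.lt_succ_self)) (fun i hi => hy i (hi.trans N.le_succ))
      (fun i hi => h i (hi.trans N.lt_succ_self)) t ht, Finset.sum_range_succ _ N, add_assoc,
      fracInt_congr ht (h N N.lt_succ_self), fracInt_add hbN (KernelIntegrable.sum _ hP)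
        ((hy _ le_rfl).kernelIntegrable_fracInt _ (hb N N.lt_succ_self) ht),
      fracInt_sum hbN _ hP, fracInt_fracInt (hy _ le_rfl) hbN (hb N N.lt_succ_self) ht,
      Finset.sum_range_succ _ N]
    congr 2
    refine Finset.sum_congr rfl fun l _ => ?_
    rw [fracInt_const_mul, fracInt_powFn hbN (hneg l) ht, add_comm (l : ℝ)]

section Admissible

variable {α : ℝ} {f : ℝ → ℝ}

lemma Admissible.isRegular_derivN (hf : Admissible α f) {k : ℕ} (hk : k ≤ ⌈α⌉₊) :
    IsRegular (derivN k f) := by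
  rcases hk.eq_or_lt with rfl | hk
  · exact ⟨continuousOn_derivN_Ioi hf.contDiffOn_Ioi le_rfl, fun t ht =>
      (intervalIntegrable_iff_integrableOn_Ioc_of_le ht.le).2 (hf.integrableOn t ht)⟩
  · exact isRegular_of_continuousOn (continuousOn_derivN_Ici hf.contDiffOn_Ici (by omega))

/-- Taylor's formula with integral remainder, at a base point where the last derivative may be
singular. -/
lemma Admissible.taylor (hf : Admissible α f) {t : ℝ} (ht : 0 < t) :
    f t = ∑ l ∈ Finset.range ⌈α⌉₊, derivN l f 0 * powFn l t +
      fracInt ⌈α⌉₊ (derivN ⌈α⌉₊ f) t := by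
  have key : ∀ k < ⌈α⌉₊, ∀ t, 0 < t → derivN k f t =
      ∑ l ∈ Finset.range 1, derivN k f 0 * powFn l t + fracInt 1 (derivN (k + 1) f) t := by
    intro k hk t ht
    rw [fracInt_one, intervalIntegral.integral_eq_sub_of_hasDerivAt_of_le ht.le
      ((continuousOn_derivN_Ici hf.contDiffOn_Ici (by omega : k ≤ ⌈α⌉₊ - 1)).mono
        Icc_subset_Ici_self) (fun x hx => hasDerivAt_derivN hf.contDiffOn_Ioi hk hx.1)
      ((hf.isRegular_derivN hk).2 t ht)]
    simp [powFn]
  have h := eq_sum_powFn_add_fracInt (n := fun _ => 1) (D := fun k _ => derivN k f 0)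
    (b := fun _ => 1) (y := fun k => derivN k f) (fun _ _ => zero_le_one)
    (fun k hk => hf.isRegular_derivN hk) key t ht
  simpa [derivN_zero] using h

/-- Fractional integration inverts the Caputo derivative up to the Taylor polynomial. -/
lemma Admissible.eq_taylor_add_fracInt_caputo (hα : 0 ≤ α) (hf : Admissible α f) {g : ℝ → ℝ}
    (hg : ∀ t, 0 < t → caputo α f t = g t) {t : ℝ} (ht : 0 < t) :
    f t = ∑ l ∈ Finset.range ⌈α⌉₊, derivN l f 0 * powFn l t + fracInt α g t := by
  have h : fracInt α g t = fracInt ⌈α⌉₊ (derivN ⌈α⌉₊ f) t := by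
    rw [fracInt_congr (g := fracInt ((⌈α⌉₊ : ℝ) - α) (derivN ⌈α⌉₊ f)) ht fun s hs => by
      rw [← hg s hs, caputo_eq_fracInt], fracInt_fracInt (hf.isRegular_derivN le_rfl) hα
      (sub_nonneg.2 (Nat.le_ceil α)) ht, add_sub_cancel]
  rw [h]; exact hf.taylor ht

end Admissible

/-! ### Power expansions at zero -/

/-- A power function is not, near `0`, a combination of other powers up to a smaller term: the
operator `f ↦ f (2 ·) - 2 ^ e * f` removes the exponent `e` and preserves the situation. -/
lemma eq_zero_of_sum_rpow_isLittleO {ι : Type*} (s : Finset ι) (e : ι → ℝ) {p : ℝ}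
    (he : ∀ i ∈ s, e i ≠ p) (c : ι → ℝ) (c₀ : ℝ)
    (h : (fun t : ℝ => ∑ i ∈ s, c i * t ^ e i + c₀ * t ^ p) =o[𝓝[>] 0] fun t : ℝ => t ^ p) :
    c₀ = 0 := by
  classical
  induction s using Finset.induction_on generalizing c c₀ with
  | empty =>
    simp only [Finset.sum_empty, zero_add] at h
    have h1 : Tendsto (fun _ : ℝ => c₀) (𝓝[>] 0) (𝓝 0) := by
      refine h.tendsto_div_nhds_zero.congr' ?_
      filter_upwards [self_mem_nhdsWithin] with t ht
      rw [mul_div_cancel_right₀ _ (Real.rpow_pos_of_pos ht p).ne']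
    exact tendsto_nhds_unique tendsto_const_nhds h1
  | insert j s hj ih =>
    have h2 : Tendsto (fun t : ℝ => 2 * t) (𝓝[>] 0) (𝓝[>] 0) := by
      refine tendsto_nhdsWithin_iff.2 ⟨?_, ?_⟩
      · have : Tendsto (fun t : ℝ => 2 * t) (𝓝 0) (𝓝 (2 * 0)) :=
          tendsto_id.const_mul 2
        rw [mul_zero] at this
        exact this.mono_left nhdsWithin_le_nhds
      · filter_upwards [self_mem_nhdsWithin] with t ht
        exact mul_pos two_pos (mem_Ioi.1 ht)
    have h3 := h.comp_tendsto h2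
    have h4 : ((fun t : ℝ => t ^ p) ∘ fun t => 2 * t) =O[𝓝[>] 0] fun t : ℝ => t ^ p := by
      refine Asymptotics.IsBigO.of_bound (2 ^ p) ?_
      filter_upwards [self_mem_nhdsWithin] with t ht
      simp only [Function.comp]
      rw [Real.mul_rpow two_pos.le (le_of_lt ht), norm_mul,
        Real.norm_of_nonneg (Real.rpow_nonneg two_pos.le p)]
    have h5 := (h3.trans_isBigO h4).sub (h.const_mul_left (2 ^ e j))
    have h6 : c₀ * (2 ^ p - 2 ^ e j) = 0 := by
      refine ih (fun i hi => he i (Finset.mem_insert_of_mem hi))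
        (fun i => c i * (2 ^ e i - 2 ^ e j)) _ (h5.congr' ?_ EventuallyEq.rfl)
      filter_upwards [self_mem_nhdsWithin] with t ht
      have ht' : (0 : ℝ) ≤ t := le_of_lt ht
      simp only [Function.comp, Finset.sum_insert hj, Real.mul_rpow two_pos.le ht', mul_add,
        Finset.mul_sum]
      have : ∑ i ∈ s, c i * (2 ^ e i - 2 ^ e j) * t ^ e i =
          ∑ i ∈ s, c i * (2 ^ e i * t ^ e i) - ∑ i ∈ s, 2 ^ e j * (c i * t ^ e i) := by
        rw [← Finset.sum_sub_distrib]
        exact Finset.sum_congr rfl fun i _ => by ring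
      rw [this]; ring
    refine (mul_eq_zero.1 h6).resolve_right fun h7 => ?_
    have h8 := (Real.rpow_right_inj two_pos (by norm_num)).1 (sub_eq_zero.1 h7)
    exact he j (Finset.mem_insert_self j s) h8.symm

lemma fracInt_isBigO {g : ℝ → ℝ} (hg : ContinuousOn g (Ici 0)) {a : ℝ} (ha : 0 < a) :
    fracInt a g =O[𝓝[>] 0] fun t : ℝ => t ^ a := by
  obtain ⟨M, hM⟩ := isCompact_Icc.exists_bound_of_continuousOn
    (hg.mono (Icc_subset_Ici_self : Icc 0 (1 : ℝ) ⊆ _))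
  refine Asymptotics.IsBigO.of_bound (M / Real.Gamma (a + 1)) ?_
  filter_upwards [Ioc_mem_nhdsGT (zero_lt_one : (0 : ℝ) < 1)] with t ht
  have h1 : fracInt a (powFn 0) t = powFn a t := by
    rw [fracInt_powFn ha.le (by norm_num) ht.1, zero_add]
  have hp : 0 < (Real.Gamma a)⁻¹ := inv_pos.2 (Real.Gamma_pos_of_pos ha)
  have h2 : ‖∫ τ in (0 : ℝ)..t, (t - τ) ^ (a - 1) * g τ‖ ≤
      ∫ τ in (0 : ℝ)..t, M * ((t - τ) ^ (a - 1) * powFn 0 τ) := by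
    refine intervalIntegral.norm_integral_le_of_norm_le ht.1.le (ae_of_all _ fun τ hτ => ?_)
      (((isRegular_powFn (by norm_num)).intervalIntegrable_kernel ha ht.1).const_mul M)
    have h3 : 0 ≤ (t - τ) ^ (a - 1) := Real.rpow_nonneg (sub_nonneg.2 hτ.2) _
    have h4 := hM τ ⟨hτ.1.le, hτ.2.trans ht.2⟩
    rw [norm_mul, Real.norm_of_nonneg h3]
    simp only [powFn, Real.rpow_zero, zero_add, Real.Gamma_one, div_one, mul_one]
    rw [mul_comm M]
    gcongr
  rw [intervalIntegral.integral_const_mul] at h2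
  rw [fracInt_of_pos ha] at h1 ⊢
  rw [norm_mul, Real.norm_of_nonneg hp.le, Real.norm_of_nonneg (Real.rpow_nonneg ht.1.le a)]
  calc _ ≤ (Real.Gamma a)⁻¹ * (M * ∫ τ in (0 : ℝ)..t, (t - τ) ^ (a - 1) * powFn 0 τ) := by gcongr
    _ = M * powFn a t := by rw [← h1]; ring
    _ = _ := by rw [powFn]; ring

lemma rpow_isLittleO_rpow {p q : ℝ} (h : p < q) :
    (fun t : ℝ => t ^ q) =o[𝓝[>] 0] fun t : ℝ => t ^ p := by
  refine (Asymptotics.isLittleO_iff_tendsto' ?_).2 ?_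
  · filter_upwards [self_mem_nhdsWithin] with t ht h0
    exact absurd h0 (Real.rpow_pos_of_pos ht p).ne'
  · have h1 : Tendsto (fun t : ℝ => t ^ (q - p)) (𝓝[>] 0) (𝓝 0) := by
      have := (Real.continuousAt_rpow_const 0 (q - p) (Or.inr (by linarith))).tendsto
      rw [Real.zero_rpow (by linarith)] at this
      exact this.mono_left nhdsWithin_le_nhds
    refine h1.congr' ?_
    filter_upwards [self_mem_nhdsWithin] with t ht
    exact Real.rpow_sub ht q p

/-! ### The system forces a derivative to vanish -/

lemma natCeil_order {m k : ℕ} {α : ℕ → ℝ}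
    (hα : ∀ k ∈ Finset.Icc 1 m, (k : ℝ) - 1 < α k ∧ α k ≤ k) (hk : k ∈ Finset.Icc 1 m) :
    ⌈α k⌉₊ = k := by
  have h1 := (Finset.mem_Icc.1 hk).1
  refine (Nat.ceil_eq_iff (by omega)).2 ⟨?_, (hα k hk).2⟩
  rw [Nat.cast_sub h1, Nat.cast_one]
  exact (hα k hk).1

/-- The partial sums of the orders of the system pass through the orders of the equation. -/
lemma sum_range_order {m : ℕ} {α β : ℕ → ℝ} (hβ_first : β 0 = α 1)
    (hβ_mid : ∀ i ∈ Finset.Icc 1 (m - 2), α i + β (2 * i - 1) + β (2 * i) = α (i + 1))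
    (i : ℕ) (hi : i ≤ m - 2) : ∑ j ∈ Finset.range (2 * i + 1), β j = α (i + 1) := by
  induction i with
  | zero => simpa using hβ_first
  | succ i ih =>
    rw [show 2 * (i + 1) + 1 = 2 * i + 1 + 1 + 1 by ring, Finset.sum_range_succ,
      Finset.sum_range_succ, ih (by omega), ← hβ_mid (i + 1) (Finset.mem_Icc.2 (by omega))]
    rfl

/-- The first component of a solution of the system, if it is as smooth as a solution of the
equation, has vanishing derivative of order `m - 1` at `0`. -/
lemma SolvesSystem.derivN_eq_zero {m : ℕ} (hm : 2 ≤ m) {a α β : ℕ → ℝ}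
    (hα : ∀ k ∈ Finset.Icc 1 m, (k : ℝ) - 1 < α k ∧ α k ≤ k)
    (hα' : α (m - 1) ≠ (m : ℝ) - 1)
    (hβ : ∀ j < 2 * m - 2, 0 < β j)
    (hβ_first : β 0 = α 1)
    (hβ_mid : ∀ i ∈ Finset.Icc 1 (m - 2), α i + β (2 * i - 1) + β (2 * i) = α (i + 1))
    (hβ_last : α (m - 1) + β (2 * m - 3) = α m)
    {x : ℝ → ℝ} (hx : Admissible (α m) x) {y : ℕ → ℝ → ℝ} (hy : SolvesSystem m a β y)
    (hxy : EqOn x (y 0) (Ici 0)) : derivN (m - 1) x 0 = 0 := by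
  obtain ⟨g, hg⟩ : ∃ g : ℝ → ℝ, g = fun t => -1 / a m *
    (a 0 * y 0 t + ∑ i ∈ Finset.Icc 1 (m - 1), a i * y (2 * i - 1) t) := ⟨_, rfl⟩
  set N := 2 * m - 2 with hN
  have hyc : ∀ i < N, ContinuousOn (y i) (Ici 0) := fun i hi =>
    (hy.admissible i hi).contDiffOn_Ici.continuousOn
  have hgc : ContinuousOn g (Ici 0) := by
    rw [hg]
    refine continuousOn_const.mul ((continuousOn_const.mul (hyc 0 (by omega))).add
      (continuousOn_finsetSum _ fun i hi => continuousOn_const.mul (hyc _ ?_)))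
    have := Finset.mem_Icc.1 hi
    omega
  -- the right-hand side of the last equation continues the chain `y 0, …, y (2 * m - 3)`
  obtain ⟨Y, hY⟩ : ∃ Y : ℕ → ℝ → ℝ, Y = fun i => if i < N then y i else g := ⟨_, rfl⟩
  have hYlt : ∀ i < N, Y i = y i := fun i hi => by simp [hY, hi]
  have hYN : Y N = g := by simp [hY]
  have hYr : ∀ i ≤ N, IsRegular (Y i) := by
    intro i hi
    rcases hi.eq_or_lt with rfl | hi
    · rw [hYN]; exact isRegular_of_continuousOn hgc
    · rw [hYlt i hi]; exact isRegular_of_continuousOn (hyc i hi)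
  set γ : ℕ → ℝ := fun i => ∑ j ∈ Finset.range i, β j with hγ
  have hγ1 : γ (2 * m - 3) = α (m - 1) := by
    have := sum_range_order hβ_first hβ_mid (m - 2) le_rfl
    rwa [show 2 * (m - 2) + 1 = 2 * m - 3 by omega, show m - 2 + 1 = m - 1 by omega] at this
  have hγN : γ N = α m := by
    rw [← hβ_last, ← hγ1, hN, show 2 * m - 2 = 2 * m - 3 + 1 by omega]
    exact Finset.sum_range_succ _ _
  have hexp : ∀ t, 0 < t → Y 0 t = ∑ i ∈ Finset.range N, ∑ l ∈ Finset.range ⌈β i⌉₊,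
      derivN l (y i) 0 * powFn (γ i + l) t + fracInt (γ N) (Y N) t := by
    refine eq_sum_powFn_add_fracInt (fun i hi => (hβ i hi).le) hYr fun i hi t ht => ?_
    rw [hYlt i hi]
    refine (hy.admissible i hi).eq_taylor_add_fracInt_caputo (hβ i hi).le (fun s hs => ?_) ht
    by_cases h : i + 1 < N
    · rw [hYlt _ h, hy.chain i (by omega) s hs]
    · obtain rfl : i = 2 * m - 3 := by omega
      rw [show 2 * m - 3 + 1 = N by omega, hYN, hg, hy.last s hs]
  have hmm : m ∈ Finset.Icc 1 m := Finset.mem_Icc.2 (by omega)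
  have hm1 : m - 1 ∈ Finset.Icc 1 m := Finset.mem_Icc.2 (by omega)
  have hcast : ((m - 1 : ℕ) : ℝ) = (m : ℝ) - 1 := by rw [Nat.cast_sub (by omega), Nat.cast_one]
  have hαm := hα m hmm
  have hαm1 := hα (m - 1) hm1
  rw [hcast] at hαm1
  have hlt : α (m - 1) < (m : ℝ) - 1 := lt_of_le_of_ne hαm1.2 hα'
  -- Taylor expansion of `x`
  have hT : (fun t => x t - ∑ k ∈ Finset.range (m - 1 + 1), derivN k x 0 * powFn k t) =o[𝓝[>] 0]
      fun t : ℝ => t ^ ((m - 1 : ℕ) : ℝ) := by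
    have hc := hx.contDiffOn_Ici
    rw [natCeil_order hα hmm] at hc
    have h := (taylor_isLittleO (convex_Ici 0) self_mem_Ici hc).mono
      (nhdsWithin_mono 0 Ioi_subset_Ici_self)
    refine h.congr (fun t => ?_) fun t => ?_
    · rw [taylor_within_apply]
      congr 1
      refine Finset.sum_congr rfl fun k _ => ?_
      rw [powFn, Real.Gamma_nat_eq_factorial, Real.rpow_natCast, derivN, smul_eq_mul, sub_zero]
      ring
    · rw [sub_zero, Real.rpow_natCast]
  have hR : fracInt (γ N) (Y N) =o[𝓝[>] 0] fun t : ℝ => t ^ ((m - 1 : ℕ) : ℝ) := by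
    rw [hYN, hγN]
    have hpos : 0 < α m := by
      have : (2 : ℝ) ≤ m := by exact_mod_cast hm
      linarith [hαm.1]
    refine (fracInt_isBigO hgc hpos).trans_isLittleO (rpow_isLittleO_rpow ?_)
    rw [hcast]; exact hαm.1
  set s : Finset ((Σ _ : ℕ, ℕ) ⊕ ℕ) :=
    ((Finset.range N).sigma fun i => Finset.range ⌈β i⌉₊).disjSum (Finset.range (m - 1)) with hs
  set e : (Σ _ : ℕ, ℕ) ⊕ ℕ → ℝ := Sum.elim (fun q => γ q.1 + q.2) fun k => k with he
  set c : (Σ _ : ℕ, ℕ) ⊕ ℕ → ℝ := Sum.elim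
    (fun q => derivN q.2 (y q.1) 0 / Real.Gamma (γ q.1 + q.2 + 1))
    (fun k => -derivN k x 0 / Real.Gamma (k + 1)) with hc
  have hep : ∀ i ∈ s, e i ≠ ((m - 1 : ℕ) : ℝ) := by
    intro i hi hei
    rcases i with ⟨i, l⟩ | k
    · simp only [hs, Finset.inl_mem_disjSum, Finset.mem_sigma, Finset.mem_range] at hi
      obtain ⟨hi, hl⟩ := hi
      replace hl := Nat.lt_ceil.1 hl
      simp only [he, Sum.elim_inl, hcast] at hei
      rcases (show i ≤ 2 * m - 3 by omega).eq_or_lt with rfl | hi'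
      · -- here `α (m - 1) + l = m - 1`, although `α (m - 1)` lies strictly between `m - 2`
        -- and `m - 1`
        rw [hγ1] at hei
        have h1 : (0 : ℝ) < l := by linarith
        have h2 : (l : ℝ) < 1 := by linarith
        have h3 : 0 < l := by exact_mod_cast h1
        have h4 : l < 1 := by exact_mod_cast h2
        omega
      · -- here `γ i + l < γ i + β i = γ (i + 1) ≤ α (m - 1)`
        have h1 : γ (i + 1) ≤ γ (2 * m - 3) :=
          Finset.sum_le_sum_of_subset_of_nonneg (Finset.range_subset_range.2 hi') fun j hj _ =>
            (hβ j (by have := Finset.mem_range.1 hj; omega)).le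
        have h2 : γ (i + 1) = γ i + β i := Finset.sum_range_succ _ _
        linarith
    · simp only [hs, Finset.inr_mem_disjSum, Finset.mem_range] at hi
      simp only [he, Sum.elim_inr, Nat.cast_inj] at hei
      omega
  have h0 := eq_zero_of_sum_rpow_isLittleO s e hep c
    (-derivN (m - 1) x 0 / Real.Gamma ((m - 1 : ℕ) + 1)) (by
      refine (hT.sub hR).congr' ?_ EventuallyEq.rfl
      filter_upwards [self_mem_nhdsWithin] with t ht
      have ht' : 0 < t := ht
      have h := hexp t ht'
      rw [hYlt 0 (by omega), ← hxy ht'.le] at h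
      rw [h, hs, Finset.sum_disjSum, Finset.sum_sigma, Finset.sum_range_succ]
      simp only [hc, he, Sum.elim_inl, Sum.elim_inr, powFn, neg_div, neg_mul,
        Finset.sum_neg_distrib]
      simp only [mul_div_assoc', div_mul_eq_mul_div]
      ring)
  have hG : Real.Gamma ((m - 1 : ℕ) + 1) ≠ 0 := (Real.Gamma_pos_of_pos (by positivity)).ne'
  simpa [hG] using h0

/-! ### Volterra equations with weakly singular kernels -/

/-- The kernel of the Riemann–Liouville integral of order `ε`, damped by `exp (-r s)`. -/
noncomputable def dampedKernel (ε r s : ℝ) : ℝ :=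
  (Real.Gamma ε)⁻¹ * (s ^ (ε - 1) * Real.exp (-(r * s)))

section DampedKernel

variable {ε r : ℝ}

lemma dampedKernel_nonneg (hε : 0 < ε) {s : ℝ} (hs : 0 ≤ s) : 0 ≤ dampedKernel ε r s :=
  mul_nonneg (inv_nonneg.2 (Real.Gamma_pos_of_pos hε).le)
    (mul_nonneg (Real.rpow_nonneg hs _) (Real.exp_pos _).le)

lemma integral_dampedKernel (hε : 0 < ε) (hr : 0 < r) :
    ∫ s in Ioi 0, dampedKernel ε r s = r ^ (-ε) := by
  unfold dampedKernel
  rw [integral_const_mul, Real.integral_rpow_mul_exp_neg_mul_Ioi hε hr, mul_comm,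
    mul_inv_cancel_right₀ (Real.Gamma_pos_of_pos hε).ne', one_div, Real.inv_rpow hr.le,
    Real.rpow_neg hr.le]

lemma integrable_dampedKernel (hε : 0 < ε) (hr : 0 < r) :
    Integrable (dampedKernel ε r) (volume.restrict (Ioi 0)) := by
  refine Integrable.of_integral_ne_zero ?_
  rw [integral_dampedKernel hε hr]
  exact (Real.rpow_pos_of_pos hr _).ne'

lemma integrable_dampedKernel_mul (hε : 0 < ε) (hr : 0 < r) (u : BoundedContinuousFunction ℝ ℝ)
    (t : ℝ) : Integrable (fun s => dampedKernel ε r s * u (t - s)) (volume.restrict (Ioi 0)) :=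
  (integrable_dampedKernel hε hr).mul_bdd (c := ‖u‖)
    (u.continuous.comp (continuous_const.sub continuous_id)).aestronglyMeasurable
    (ae_of_all _ fun _ => u.norm_coe_le_norm _)

lemma norm_integral_dampedKernel_mul_le (hε : 0 < ε) (hr : 0 < r) {v : ℝ → ℝ} {M : ℝ}
    (hv : ∀ s, ‖v s‖ ≤ M) :
    ‖∫ s in Ioi 0, dampedKernel ε r s * v s‖ ≤ r ^ (-ε) * M := by
  rw [← integral_dampedKernel hε hr, ← integral_mul_const]
  refine norm_integral_le_of_norm_le ((integrable_dampedKernel hε hr).mul_const M) ?_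
  filter_upwards [ae_restrict_mem measurableSet_Ioi] with s hs
  have := dampedKernel_nonneg (r := r) hε (le_of_lt hs)
  rw [norm_mul, Real.norm_of_nonneg this]
  gcongr
  exact hv s

/-- Convolution with the damped kernel, as an operator on bounded continuous functions on `ℝ`. -/
noncomputable def dampedOp (ε r : ℝ) (hε : 0 < ε) (hr : 0 < r)
    (u : BoundedContinuousFunction ℝ ℝ) : BoundedContinuousFunction ℝ ℝ :=
  BoundedContinuousFunction.ofNormedAddCommGroup
    (fun t => ∫ s in Ioi 0, dampedKernel ε r s * u (t - s))
    (continuous_of_dominated (bound := fun s => ‖dampedKernel ε r s‖ * ‖u‖)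
      (fun t => (integrable_dampedKernel_mul hε hr u t).aestronglyMeasurable)
      (fun t => ae_of_all _ fun s => by
        rw [norm_mul]; gcongr; exact u.norm_coe_le_norm _)
      ((integrable_dampedKernel hε hr).norm.mul_const _)
      (ae_of_all _ fun s => continuous_const.mul
        (u.continuous.comp (continuous_id.sub continuous_const))))
    (r ^ (-ε) * ‖u‖)
    (fun _ => norm_integral_dampedKernel_mul_le hε hr fun _ => u.norm_coe_le_norm _)

lemma dampedOp_apply (hε : 0 < ε) (hr : 0 < r) (u : BoundedContinuousFunction ℝ ℝ) (t : ℝ) :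
    dampedOp ε r hε hr u t = ∫ s in Ioi 0, dampedKernel ε r s * u (t - s) := rfl

lemma dist_dampedOp_le (hε : 0 < ε) (hr : 0 < r) (u w : BoundedContinuousFunction ℝ ℝ) :
    dist (dampedOp ε r hε hr u) (dampedOp ε r hε hr w) ≤ r ^ (-ε) * dist u w := by
  refine (BoundedContinuousFunction.dist_le (by positivity)).2 fun t => ?_
  rw [dampedOp_apply, dampedOp_apply, dist_eq_norm, ← integral_sub
    (integrable_dampedKernel_mul hε hr u t) (integrable_dampedKernel_mul hε hr w t)]
  simp only [← mul_sub]
  refine norm_integral_dampedKernel_mul_le hε hr fun s => ?_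
  rw [← dist_eq_norm]
  exact BoundedContinuousFunction.dist_coe_le_dist _

lemma dampedOp_eq_zero (hε : 0 < ε) (hr : 0 < r) {u : BoundedContinuousFunction ℝ ℝ}
    (hu : ∀ t ≤ 0, u t = 0) {t : ℝ} (ht : t ≤ 0) : dampedOp ε r hε hr u t = 0 := by
  rw [dampedOp_apply]
  refine setIntegral_eq_zero_of_forall_eq_zero fun s hs => ?_
  rw [hu _ (by linarith [mem_Ioi.1 hs]), mul_zero]

/-- Damping conjugates the fractional integral to the convolution operator. -/
lemma fracInt_exp_mul (hε : 0 < ε) (hr : 0 < r) {u : BoundedContinuousFunction ℝ ℝ}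
    (hu : ∀ t ≤ 0, u t = 0) {t : ℝ} (ht : 0 < t) :
    fracInt ε (fun τ => Real.exp (r * τ) * u τ) t =
      Real.exp (r * t) * dampedOp ε r hε hr u t := by
  have h1 : ∫ s in Ioi 0, dampedKernel ε r s * u (t - s) =
      ∫ s in Ioc 0 t, dampedKernel ε r s * u (t - s) := by
    refine (setIntegral_eq_of_subset_of_forall_sdiff_eq_zero measurableSet_Ioi Ioc_subset_Ioi_self
      fun s hs => ?_)
    have : t < s := not_le.1 fun h => hs.2 ⟨hs.1, h⟩
    rw [hu _ (by linarith), mul_zero]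
  rw [dampedOp_apply, h1, ← intervalIntegral.integral_of_le ht.le, fracInt_of_pos hε]
  have h2 := intervalIntegral.integral_comp_sub_left (a := 0) (b := t)
    (fun τ => (t - τ) ^ (ε - 1) * (Real.exp (r * τ) * u τ)) t
  rw [sub_self, sub_zero] at h2
  rw [← h2, ← intervalIntegral.integral_const_mul, ← intervalIntegral.integral_const_mul]
  congr 1
  ext s
  rw [sub_sub_cancel, dampedKernel, mul_sub, Real.exp_sub, Real.exp_neg]
  field_simp

end DampedKernel

/-- The linear Volterra equation `z + ∑ bᵢ I^{εᵢ} z = h` on `(0, ∞)` has a regular solution. -/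
def VolterraSolvable {ι : Type*} (s : Finset ι) (b ε : ι → ℝ) (h : ℝ → ℝ) : Prop :=
  ∃ z : ℝ → ℝ, IsRegular z ∧ ∀ t, 0 < t → z t + ∑ i ∈ s, b i * fracInt (ε i) z t = h t

section Volterra

variable {ι : Type*} {s : Finset ι} {b ε : ι → ℝ}

/-- For a right-hand side that is continuous at `0` the Volterra equation is solved by the
contraction principle: after damping by `exp (-r t)` with `r` large, the integral operator has norm
at most `1 / 2` on the bounded continuous functions. -/
lemma volterraSolvable_rpow_of_pos (hε : ∀ i ∈ s, 0 < ε i) {e : ℝ} (he : 0 < e) :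
    VolterraSolvable s b ε (fun t => t ^ e) := by
  classical
  obtain ⟨r, hr, hre, hrb⟩ : ∃ r : ℝ, 0 < r ∧ e ≤ r ∧ ∑ i ∈ s, |b i| * r ^ (-ε i) ≤ 1 / 2 := by
    have h1 : Tendsto (fun r : ℝ => ∑ i ∈ s, |b i| * r ^ (-ε i)) atTop (𝓝 (∑ i ∈ s, |b i| * 0)) :=
      tendsto_finsetSum _ fun i hi => (tendsto_rpow_neg_atTop (hε i hi)).const_mul _
    simp only [mul_zero, Finset.sum_const_zero] at h1
    exact ((eventually_gt_atTop 0).and ((eventually_ge_atTop e).and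
      (h1.eventually_le_const (by norm_num)))).exists
  -- `t ^ e ≤ exp (e * t)` as `log t ≤ t`, so the damped right-hand side is bounded once `e ≤ r`
  have hHb : ∀ t : ℝ, ‖Real.exp (-(r * t)) * max t 0 ^ e‖ ≤ 1 := by
    intro t
    rcases le_or_gt t 0 with ht | ht
    · rw [max_eq_right ht, Real.zero_rpow he.ne']; simp
    · rw [max_eq_left ht.le, Real.rpow_def_of_pos ht, ← Real.exp_add,
        Real.norm_of_nonneg (Real.exp_pos _).le, Real.exp_le_one_iff]
      have h1 := Real.log_le_sub_one_of_pos ht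
      nlinarith
  let H : BoundedContinuousFunction ℝ ℝ := BoundedContinuousFunction.ofNormedAddCommGroup
    (fun t => Real.exp (-(r * t)) * max t 0 ^ e)
    (by
      have : Continuous fun t : ℝ => max t 0 ^ e :=
        (continuous_id.max continuous_const).rpow_const fun _ => Or.inr he.le
      fun_prop) 1 hHb
  have hH : ∀ t, H t = Real.exp (-(r * t)) * max t 0 ^ e := fun _ => rfl
  let F : BoundedContinuousFunction ℝ ℝ → BoundedContinuousFunction ℝ ℝ := fun u =>
    H - ∑ i ∈ s.attach, b i • dampedOp (ε i) r (hε i i.2) hr u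
  have hFval : ∀ u t, F u t = H t - ∑ i ∈ s.attach, b i * dampedOp (ε i) r (hε i i.2) hr u t :=
    fun u t => by simp [F, BoundedContinuousFunction.coe_sum]
  have hF : ContractingWith (1 / 2) F := by
    refine ⟨by rw [← NNReal.coe_lt_coe]; norm_num, LipschitzWith.of_dist_le_mul fun u w => ?_⟩
    have h1 : dist (F u) (F w) ≤
        ∑ i ∈ s.attach, |b i| * r ^ (-ε i) * dist u w := by
      simp only [F, dist_sub_left]
      refine (dist_sum_sum_le_of_le _ fun i _ => ?_)
      refine (dist_smul_le (b i) (dampedOp (ε i) r (hε i i.2) hr u)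
        (dampedOp (ε i) r (hε i i.2) hr w)).trans ?_
      rw [Real.norm_eq_abs, mul_assoc]
      gcongr
      exact dist_dampedOp_le _ hr u w
    rw [← Finset.sum_mul, s.sum_attach fun i => |b i| * r ^ (-ε i)] at h1
    refine h1.trans ?_
    push_cast
    gcongr
  set u := ContractingWith.fixedPoint F hF with hu
  have hfix : F u = u := hF.fixedPoint_isFixedPt
  -- vanishing on `(-∞, 0]` passes from the iterates of `0` to the fixed point
  have hzero : ∀ t ≤ 0, u t = 0 := by
    intro t ht
    have hit : ∀ n : ℕ, ∀ t ≤ 0, (F^[n] 0) t = 0 := by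
      intro n
      induction n with
      | zero => intro t _; rfl
      | succ n ih =>
        intro t ht
        rw [Function.iterate_succ_apply', hFval, hH, max_eq_right ht, Real.zero_rpow he.ne',
          Finset.sum_eq_zero fun i _ => by rw [dampedOp_eq_zero _ hr ih ht, mul_zero]]
        simp
    have h1 : Tendsto (fun n => (F^[n] 0) t) atTop (𝓝 (u t)) :=
      ((BoundedContinuousFunction.evalCLM ℝ t).continuous.tendsto u).comp
        (hF.tendsto_iterate_fixedPoint 0)
    exact tendsto_nhds_unique h1 (by simp only [hit _ t ht]; exact tendsto_const_nhds)
  refine ⟨fun t => Real.exp (r * t) * u t, isRegular_of_continuousOn ?_, fun t ht => ?_⟩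
  · exact (Continuous.mul (by fun_prop) u.continuous).continuousOn
  · have h1 := hFval u t
    rw [hfix, hH, max_eq_left ht.le] at h1
    rw [← s.sum_attach]
    have h2 : ∀ i ∈ s.attach, b i * fracInt (ε i) (fun τ => Real.exp (r * τ) * u τ) t =
        Real.exp (r * t) * (b i * dampedOp (ε i) r (hε i i.2) hr u t) := fun i _ => by
      rw [fracInt_exp_mul (hε i i.2) hr hzero ht]; ring
    rw [Finset.sum_congr rfl h2, ← Finset.mul_sum, ← mul_add, h1, sub_add_cancel, ← mul_assoc,
      ← Real.exp_add, add_neg_cancel, Real.exp_zero, one_mul]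

lemma VolterraSolvable.const_mul {h : ℝ → ℝ} (hh : VolterraSolvable s b ε h) (c : ℝ) :
    VolterraSolvable s b ε (fun t => c * h t) := by
  obtain ⟨z, hz, hzt⟩ := hh
  refine ⟨_, hz.const_mul c, fun t ht => ?_⟩
  beta_reduce
  rw [← hzt t ht, mul_add, Finset.mul_sum]
  congr 1
  refine Finset.sum_congr rfl fun i _ => ?_
  rw [fracInt_const_mul]; ring

lemma VolterraSolvable.sum (hε : ∀ i ∈ s, 0 < ε i) {κ : Type*} (q : Finset κ) {h : κ → ℝ → ℝ}
    (hh : ∀ k ∈ q, VolterraSolvable s b ε (h k)) :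
    VolterraSolvable s b ε (fun t => ∑ k ∈ q, h k t) := by
  choose! z hz hzt using hh
  refine ⟨_, IsRegular.sum q hz, fun t ht => ?_⟩
  beta_reduce
  rw [← Finset.sum_congr rfl fun k hk => hzt k hk t ht, Finset.sum_add_distrib, Finset.sum_comm]
  congr 1
  refine Finset.sum_congr rfl fun i hi => ?_
  rw [fracInt_sum (hε i hi).le q fun k hk => (hz k hk).kernelIntegrable _ ht, Finset.mul_sum]

/-- The Volterra equation is solvable for a right-hand side that is an integrable power: writing the
solution as the right-hand side minus a correction raises the exponents by the `ε i`, until they are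
positive. -/
lemma volterraSolvable_rpow (hε : ∀ i ∈ s, 0 < ε i) {e : ℝ} (he : -1 < e) :
    VolterraSolvable s b ε (fun t => t ^ e) := by
  obtain ⟨δ, hδ, hδε⟩ : ∃ δ : ℝ, 0 < δ ∧ ∀ i ∈ s, δ ≤ ε i := by
    rcases s.eq_empty_or_nonempty with rfl | hs
    · exact ⟨1, one_pos, by simp⟩
    · obtain ⟨j, hj, hmin⟩ := s.exists_min_image ε hs
      exact ⟨ε j, hε j hj, hmin⟩
  obtain ⟨n, hn⟩ := exists_nat_gt (1 / δ)
  have hn' : 0 < e + n * δ := by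
    have := (div_lt_iff₀ hδ).1 hn
    linarith
  clear hn
  induction n generalizing e with
  | zero => exact volterraSolvable_rpow_of_pos hε (by simpa using hn')
  | succ n ih =>
    have hstep : VolterraSolvable s b ε
        (fun t => ∑ i ∈ s, b i * fracInt (ε i) (fun t => t ^ e) t) := by
      have hterm : ∀ i ∈ s, VolterraSolvable s b ε
          (fun t => b i * (Real.Gamma (e + 1) / Real.Gamma (e + ε i + 1)) * t ^ (e + ε i)) :=
        fun i hi => (ih (by linarith [hε i hi]) (by
          push_cast at hn'; linarith [hδε i hi])).const_mul _
      obtain ⟨z, hz, hzt⟩ := VolterraSolvable.sum hε s hterm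
      refine ⟨z, hz, fun t ht => (hzt t ht).trans (Finset.sum_congr rfl fun i hi => ?_)⟩
      have hG : Real.Gamma (e + 1) ≠ 0 := (Real.Gamma_pos_of_pos (by linarith)).ne'
      have h1 : (fun t : ℝ => t ^ e) = fun t => Real.Gamma (e + 1) * powFn e t := by
        ext t; rw [powFn, mul_div_cancel₀ _ hG]
      rw [h1, fracInt_const_mul, fracInt_powFn (hε i hi).le he ht, powFn]
      ring
    obtain ⟨w, hw, hwt⟩ := hstep
    refine ⟨fun t => t ^ e + -1 * w t, (isRegular_rpow he).add (hw.const_mul _), fun t ht => ?_⟩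
    have h2 : ∀ i ∈ s, b i * fracInt (ε i) (fun t => t ^ e + -1 * w t) t =
        b i * fracInt (ε i) (fun t => t ^ e) t - b i * fracInt (ε i) w t := fun i hi => by
      rw [fracInt_add (hε i hi).le ((isRegular_rpow he).kernelIntegrable _ ht)
        ((hw.const_mul _).kernelIntegrable _ ht), fracInt_const_mul]
      ring
    rw [Finset.sum_congr rfl h2, Finset.sum_sub_distrib]
    have h3 := hwt t ht
    beta_reduce at h3 ⊢
    rw [← h3]
    ring

end Volterra

/-! ### Solutions of the equation -/

/-- Iterated primitives of `z`: the `(n + 1)`-st one takes the value `c n` at `0` and has the `n`-th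
one as its derivative. -/
noncomputable def iterPrim (c : ℕ → ℝ) (z : ℝ → ℝ) : ℕ → ℝ → ℝ
  | 0 => z
  | n + 1 => fun t => c n + ∫ τ in (0 : ℝ)..t, iterPrim c z n τ

section IterPrim

variable {c : ℕ → ℝ} {z : ℝ → ℝ}

lemma iterPrim_succ (n : ℕ) (t : ℝ) :
    iterPrim c z (n + 1) t = c n + ∫ τ in (0 : ℝ)..t, iterPrim c z n τ := rfl

lemma IsRegular.continuousOn_primitive {g : ℝ → ℝ} (hg : IsRegular g) :
    ContinuousOn (fun t => ∫ τ in (0 : ℝ)..t, g τ) (Ici 0) := by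
  intro t ht
  have ht0 : (0 : ℝ) ≤ t := ht
  have ht1 : 0 < t + 1 := by linarith
  have h := intervalIntegral.continuousOn_primitive_interval' (hg.2 (t + 1) ht1) left_mem_uIcc
  rw [uIcc_of_le ht1.le] at h
  refine (h t ⟨ht, by linarith⟩).mono_of_mem_nhdsWithin ?_
  filter_upwards [self_mem_nhdsWithin, mem_nhdsWithin_of_mem_nhds (Iio_mem_nhds (lt_add_one t))]
    with s h1 h2
  exact ⟨h1, le_of_lt h2⟩

lemma iterPrim_isRegular (hz : IsRegular z) (n : ℕ) : IsRegular (iterPrim c z n) := by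
  induction n with
  | zero => exact hz
  | succ n ih => exact isRegular_of_continuousOn (continuousOn_const.add ih.continuousOn_primitive)

lemma iterPrim_continuousOn (hz : IsRegular z) (n : ℕ) :
    ContinuousOn (iterPrim c z (n + 1)) (Ici 0) :=
  continuousOn_const.add (iterPrim_isRegular hz n).continuousOn_primitive

lemma iterPrim_hasDerivAt (hz : IsRegular z) (n : ℕ) {t : ℝ} (ht : 0 < t) :
    HasDerivAt (iterPrim c z (n + 1)) (iterPrim c z n t) t := by
  have hr := iterPrim_isRegular (c := c) hz n
  exact (intervalIntegral.integral_hasDerivAt_right (hr.2 t ht)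
    (hr.1.stronglyMeasurableAtFilter isOpen_Ioi t ht)
    (hr.1.continuousAt (Ioi_mem_nhds ht))).const_add (c n)

lemma iterPrim_hasDerivWithinAt (hz : IsRegular z) (n : ℕ) {t : ℝ} (ht : 0 ≤ t) :
    HasDerivWithinAt (iterPrim c z (n + 2)) (iterPrim c z (n + 1) t) (Ici 0) t := by
  -- extend the integrand continuously to the left of `0`
  have hg : Continuous fun s => iterPrim c z (n + 1) (max s 0) :=
    (iterPrim_continuousOn hz n).comp_continuous (continuous_id.max continuous_const)
      fun s => mem_Ici.2 (le_max_right _ _)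
  have h := ((hg.integral_hasStrictDerivAt 0 t).hasDerivAt.const_add
    (c (n + 1))).hasDerivWithinAt (s := Ici 0)
  rw [max_eq_left ht] at h
  have heq : ∀ s ∈ Ici (0 : ℝ), iterPrim c z (n + 2) s =
      c (n + 1) + ∫ τ in (0 : ℝ)..s, iterPrim c z (n + 1) (max τ 0) := by
    intro s hs
    rw [iterPrim_succ]
    congr 1
    refine intervalIntegral.integral_congr fun τ hτ => ?_
    rw [uIcc_of_le hs] at hτ
    rw [max_eq_left hτ.1]
  exact h.congr heq (heq t ht)

lemma derivN_iterPrim (hz : IsRegular z) {n k : ℕ} (hk : k < n) {t : ℝ} (ht : 0 ≤ t) :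
    derivN k (iterPrim c z n) t = iterPrim c z (n - k) t := by
  induction k generalizing t with
  | zero => rw [derivN_zero]; rfl
  | succ k ih =>
    have heq : EqOn (derivN k (iterPrim c z n)) (iterPrim c z (n - k)) (Ici 0) :=
      fun s hs => ih (by omega) hs
    rw [derivN_succ, derivWithin_congr heq (heq ht)]
    have h := iterPrim_hasDerivWithinAt (c := c) hz (n - (k + 1) - 1) ht
    rw [show n - (k + 1) - 1 + 2 = n - k by omega,
      show n - (k + 1) - 1 + 1 = n - (k + 1) by omega] at h
    exact h.derivWithin (uniqueDiffOn_Ici 0 t ht)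

lemma derivN_iterPrim_of_pos (hz : IsRegular z) {n k : ℕ} (hk : k ≤ n) {t : ℝ} (ht : 0 < t) :
    derivN k (iterPrim c z n) t = iterPrim c z (n - k) t := by
  rcases hk.lt_or_eq with hk | rfl
  · exact derivN_iterPrim hz hk ht.le
  rcases k with _ | k
  · rw [derivN_zero]
  have heq : EqOn (derivN k (iterPrim c z (k + 1))) (iterPrim c z (k + 1 - k)) (Ici 0) :=
    fun s hs => derivN_iterPrim hz k.lt_succ_self hs
  rw [derivN_succ, derivWithin_congr heq (heq ht.le), derivWithin_of_mem_nhds (Ici_mem_nhds ht),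
    Nat.sub_self, show k + 1 - k = 0 + 1 by omega]
  exact (iterPrim_hasDerivAt hz 0 ht).deriv

lemma admissible_iterPrim (hz : IsRegular z) {n : ℕ} {α : ℝ} (hα : 0 < α) (hαn : ⌈α⌉₊ ≤ n) :
    Admissible α (iterPrim c z n) := by
  have hpos : 0 < ⌈α⌉₊ := Nat.ceil_pos.2 hα
  refine ⟨?_, ?_, fun T hT => ?_⟩
  · refine (contDiffOn_nat_iff_continuousOn_differentiableOn_deriv (uniqueDiffOn_Ici 0)).2
      ⟨fun k hk => ?_, fun k hk => ?_⟩
    · have h := iterPrim_continuousOn (c := c) hz (n - k - 1)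
      rw [show n - k - 1 + 1 = n - k by omega] at h
      exact h.congr fun t ht => derivN_iterPrim hz (by omega) ht
    · intro t ht
      have h := (iterPrim_hasDerivWithinAt (c := c) hz (n - k - 2) ht).differentiableWithinAt
      rw [show n - k - 2 + 2 = n - k by omega] at h
      exact h.congr (fun t ht => derivN_iterPrim hz (by omega) ht)
        (derivN_iterPrim hz (by omega) ht)
  · have heq : ∀ k ≤ n, ∀ t ∈ Ioi (0 : ℝ),
        iteratedDerivWithin k (iterPrim c z n) (Ioi 0) t = iterPrim c z (n - k) t :=
      fun k hk t ht => (iteratedDerivWithin_Ioi_eq_derivN k _ ht).trans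
        (derivN_iterPrim_of_pos hz hk ht)
    refine (contDiffOn_nat_iff_continuousOn_differentiableOn_deriv (uniqueDiffOn_Ioi 0)).2
      ⟨fun k hk => (iterPrim_isRegular hz (n - k)).1.congr (heq k (by omega)), fun k hk t ht => ?_⟩
    have h := (iterPrim_hasDerivAt (c := c) hz (n - k - 1)
      (mem_Ioi.1 ht)).differentiableAt.differentiableWithinAt (s := Ioi 0)
    rw [show n - k - 1 + 1 = n - k by omega] at h
    exact h.congr (heq k (by omega)) (heq k (by omega) t ht)
  · exact ((intervalIntegrable_iff_integrableOn_Ioc_of_le hT.le).1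
      ((iterPrim_isRegular (c := c) hz (n - ⌈α⌉₊)).2 T hT)).congr_fun
      (fun t ht => (derivN_iterPrim_of_pos hz hαn ht.1).symm) measurableSet_Ioc

/-- Cauchy's formula for the iterated primitives. -/
lemma iterPrim_eq_sum_powFn_add_fracInt (hz : IsRegular z) (n : ℕ) {t : ℝ} (ht : 0 < t) :
    iterPrim c z n t =
      ∑ l ∈ Finset.range n, c (n - 1 - l) * powFn l t + fracInt n z t := by
  induction n generalizing t with
  | zero => simp [fracInt_zero, iterPrim]
  | succ n ih =>
    have hneg : ∀ l : ℕ, (-1 : ℝ) < l := fun l => by linarith [(Nat.cast_nonneg l : (0 : ℝ) ≤ l)]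
    have hP : ∀ l ∈ Finset.range n, KernelIntegrable 1 t
        (fun s => c (n - 1 - l) * powFn l s) := fun l _ =>
      ((isRegular_powFn (hneg l)).const_mul _).kernelIntegrable _ ht
    rw [iterPrim_succ, ← fracInt_one, fracInt_congr ht fun s hs => ih hs,
      fracInt_add zero_le_one (KernelIntegrable.sum _ hP)
        (hz.kernelIntegrable_fracInt _ n.cast_nonneg ht),
      fracInt_sum zero_le_one _ hP, fracInt_fracInt hz zero_le_one n.cast_nonneg ht,
      Finset.sum_range_succ', add_comm (1 : ℝ), Nat.cast_succ]
    have h0 : powFn ((0 : ℕ) : ℝ) t = 1 := by simp [powFn]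
    rw [h0, mul_one, add_comm (c n), add_right_comm]
    congr 2
    refine Finset.sum_congr rfl fun l _ => ?_
    rw [fracInt_const_mul, fracInt_powFn zero_le_one (hneg l) ht, Nat.cast_succ,
      show n + 1 - 1 - (l + 1) = n - 1 - l by omega]

end IterPrim

/-- The initial value problem for the equation is solvable for all initial values: the derivative of
order `m` of the solution is found from a Volterra equation with weakly singular kernel. -/
lemma exists_solvesEquation {m : ℕ} {a α : ℕ → ℝ} (ha : a m ≠ 0)
    (hα : ∀ k ∈ Finset.Icc 1 m, (k : ℝ) - 1 < α k ∧ α k ≤ k) (C : ℕ → ℝ) :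
    ∃ x : ℝ → ℝ, SolvesEquation m a α C x := by
  -- treat the undifferentiated term as a derivative of order `0`
  obtain ⟨A, hA0, hA⟩ : ∃ A : ℕ → ℝ, A 0 = 0 ∧ ∀ k ∈ Finset.Icc 1 m, A k = α k :=
    ⟨fun k => if k = 0 then 0 else α k, by simp, fun k hk => by
      have := (Finset.mem_Icc.1 hk).1
      simp [show k ≠ 0 by omega]⟩
  have hAb : ∀ k ≤ m, (k : ℝ) - 1 < A k ∧ A k ≤ k := by
    intro k hk
    rcases k.eq_zero_or_pos with rfl | hk0
    · simp [hA0]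
    · have hk' : k ∈ Finset.Icc 1 m := Finset.mem_Icc.2 ⟨hk0, hk⟩
      rw [hA k hk']; exact hα k hk'
  have hAm := hAb m le_rfl
  have hle : ∀ k < m, (k : ℝ) ≤ m - 1 := fun k hk => by
    have : ((k + 1 : ℕ) : ℝ) ≤ m := by exact_mod_cast hk
    push_cast at this; linarith
  have hε : ∀ k ∈ Finset.range m, 0 < A m - A k := fun k hk => by
    have hk := Finset.mem_range.1 hk
    linarith [hle k hk, (hAb k hk.le).2]
  set δ : ℝ := m - A m with hδ
  have hδ0 : 0 ≤ δ := by linarith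
  have hexp : ∀ k < m, ∀ l : ℕ, -1 < (l : ℝ) + (k - A k) - δ := fun k hk l => by
    linarith [(hAb k hk.le).2, (Nat.cast_nonneg l : (0 : ℝ) ≤ l)]
  -- chosen so that `-a m * fracInt δ h` is the contribution of the initial values to the equation
  set h : ℝ → ℝ := fun t => ∑ k ∈ Finset.range m, ∑ l ∈ Finset.range (m - k),
    -(a k / a m * C (k + l)) * powFn ((l : ℝ) + (k - A k) - δ) t with hh
  have hsolv : VolterraSolvable (Finset.range m) (fun k => a k / a m) (fun k => A m - A k) h := by
    refine VolterraSolvable.sum hε _ fun k hk => VolterraSolvable.sum hε _ fun l _ =>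
      VolterraSolvable.const_mul ?_ _
    have h1 := (volterraSolvable_rpow (b := fun k => a k / a m) hε
      (hexp k (Finset.mem_range.1 hk) l)).const_mul (Real.Gamma ((l : ℝ) + (k - A k) - δ + 1))⁻¹
    simp only [← div_eq_inv_mul] at h1
    exact h1
  obtain ⟨z, hz, hzt⟩ := hsolv
  set c : ℕ → ℝ := fun n => C (m - 1 - n) with hc
  set x := iterPrim c z m with hx
  -- the fractional derivatives of `x`
  have hterm : ∀ k ≤ m, ∀ t, 0 < t → fracInt (k - A k) (derivN k x) t =
      ∑ l ∈ Finset.range (m - k), C (k + l) * powFn ((l : ℝ) + (k - A k)) t +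
        fracInt (m - A k) z t := by
    intro k hk t ht
    have hk0 : 0 ≤ (k : ℝ) - A k := by linarith [(hAb k hk).2]
    have hneg : ∀ l : ℕ, (-1 : ℝ) < l := fun l => by linarith [(Nat.cast_nonneg l : (0 : ℝ) ≤ l)]
    have hP : ∀ l ∈ Finset.range (m - k), KernelIntegrable ((k : ℝ) - A k) t
        (fun s => c (m - k - 1 - l) * powFn l s) := fun l _ =>
      ((isRegular_powFn (hneg l)).const_mul _).kernelIntegrable _ ht
    rw [fracInt_congr ht fun s hs => (derivN_iterPrim_of_pos hz hk hs).trans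
        (iterPrim_eq_sum_powFn_add_fracInt hz (m - k) hs),
      fracInt_add hk0 (KernelIntegrable.sum _ hP)
        (hz.kernelIntegrable_fracInt _ (Nat.cast_nonneg _) ht),
      fracInt_sum hk0 _ hP, fracInt_fracInt hz hk0 (Nat.cast_nonneg _) ht]
    congr 1
    · refine Finset.sum_congr rfl fun l hl => ?_
      have hl := Finset.mem_range.1 hl
      rw [fracInt_const_mul, fracInt_powFn hk0 (hneg l) ht, hc]
      beta_reduce
      rw [show m - 1 - (m - k - 1 - l) = k + l by omega]
    · rw [Nat.cast_sub hk]; congr 1; ring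
  -- the Volterra equation, integrated to the order `δ`
  have hvolt : ∀ t, 0 < t → fracInt δ z t + ∑ k ∈ Finset.range m,
      a k / a m * fracInt (m - A k) z t = ∑ k ∈ Finset.range m, ∑ l ∈ Finset.range (m - k),
        -(a k / a m * C (k + l)) * powFn ((l : ℝ) + (k - A k)) t := by
    intro t ht
    have h1 : fracInt δ (fun s => z s + ∑ k ∈ Finset.range m,
        a k / a m * fracInt (A m - A k) z s) t = fracInt δ h t := fracInt_congr ht hzt
    have hK : ∀ k ∈ Finset.range m, KernelIntegrable δ t
        (fun s => a k / a m * fracInt (A m - A k) z s) := fun k hk =>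
      (hz.kernelIntegrable_fracInt δ (hε k hk).le ht).const_mul _
    have hQ : ∀ k ∈ Finset.range m, ∀ l ∈ Finset.range (m - k), KernelIntegrable δ t (fun s =>
        -(a k / a m * C (k + l)) * powFn ((l : ℝ) + (k - A k) - δ) s) := fun k hk l _ =>
      ((isRegular_powFn (hexp k (Finset.mem_range.1 hk) l)).const_mul _).kernelIntegrable _ ht
    rw [fracInt_add hδ0 (hz.kernelIntegrable δ ht) (KernelIntegrable.sum _ hK),
      fracInt_sum hδ0 _ hK, hh,
      fracInt_sum hδ0 _ fun k hk => KernelIntegrable.sum _ (hQ k hk)] at h1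
    convert h1 using 1
    · congr 1
      refine Finset.sum_congr rfl fun k hk => ?_
      rw [fracInt_const_mul, fracInt_fracInt hz hδ0 (hε k hk).le ht]
      congr 2; rw [hδ]; ring
    · refine Finset.sum_congr rfl fun k hk => ?_
      rw [fracInt_sum hδ0 _ (hQ k hk)]
      refine Finset.sum_congr rfl fun l _ => ?_
      rw [fracInt_const_mul, fracInt_powFn hδ0 (hexp k (Finset.mem_range.1 hk) l) ht,
        sub_add_cancel]
  refine ⟨x, fun k hk => ?_, fun t ht => ?_, fun i hi => ?_⟩
  · refine admissible_iterPrim hz ?_ ?_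
    · have h1 : (1 : ℝ) ≤ k := by exact_mod_cast (Finset.mem_Icc.1 hk).1
      linarith [(hα k hk).1]
    · rw [natCeil_order hα hk]; exact (Finset.mem_Icc.1 hk).2
  · have h0 : a 0 * x t + ∑ k ∈ Finset.Icc 1 m, a k * caputo (α k) x t =
        ∑ k ∈ Finset.range (m + 1), a k * fracInt (k - A k) (derivN k x) t := by
      rw [Finset.range_eq_Ico, Finset.sum_eq_sum_Ico_succ_bot m.succ_pos]
      congr 1
      · rw [hA0, Nat.cast_zero, sub_zero, fracInt_zero, derivN_zero]
      · refine Finset.sum_congr rfl fun k hk => ?_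
        have hk' : k ∈ Finset.Icc 1 m := hk
        rw [caputo_eq_fracInt, natCeil_order hα hk', hA k hk']
    have h1 := hvolt t ht
    rw [h0, Finset.sum_range_succ, hterm m le_rfl t ht, Nat.sub_self, Finset.sum_range_zero,
      zero_add,
      Finset.sum_congr rfl fun k hk => by rw [hterm k (Finset.mem_range.1 hk).le t ht, mul_add],
      Finset.sum_add_distrib]
    have h2 : ∑ k ∈ Finset.range m, a k * fracInt (m - A k) z t =
        a m * ∑ k ∈ Finset.range m, a k / a m * fracInt (m - A k) z t := by
      rw [Finset.mul_sum]
      exact Finset.sum_congr rfl fun k _ => by field_simp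
    have h3 : ∑ k ∈ Finset.range m, a k * ∑ l ∈ Finset.range (m - k),
        C (k + l) * powFn ((l : ℝ) + (k - A k)) t =
        -(a m * ∑ k ∈ Finset.range m, ∑ l ∈ Finset.range (m - k),
          -(a k / a m * C (k + l)) * powFn ((l : ℝ) + (k - A k)) t) := by
      simp only [Finset.mul_sum, ← Finset.sum_neg_distrib]
      exact Finset.sum_congr rfl fun k _ => Finset.sum_congr rfl fun l _ => by field_simp
    rw [h2, h3, ← h1]
    ring
  · rw [hx, derivN_iterPrim hz hi le_rfl, show m - i = m - i - 1 + 1 by omega, iterPrim_succ,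
      intervalIntegral.integral_same, add_zero, hc]
    beta_reduce
    rw [show m - 1 - (m - i - 1) = i by omega]

end FracSplit

theorem mainTheorem4 (m : ℕ) (hm : 2 ≤ m) (a α β : ℕ → ℝ) (ha : a m ≠ 0)
    (hα : ∀ k ∈ Finset.Icc 1 m, (k : ℝ) - 1 < α k ∧ α k ≤ k)
    (hα' : α (m - 1) ≠ (m : ℝ) - 1)
    (hβ : ∀ j < 2 * m - 2, 0 < β j)
    (hβ_first : β 0 = α 1)
    (hβ_mid : ∀ i ∈ Finset.Icc 1 (m - 2), α i + β (2 * i - 1) + β (2 * i) = α (i + 1))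
    (hβ_last : α (m - 1) + β (2 * m - 3) = α m) :
    ¬ FracSplit.Equivalent m a α β ∧
      ∀ C : ℕ → ℝ, C (m - 1) ≠ 0 →
        (∃ x : ℝ → ℝ, FracSplit.SolvesEquation m a α C x) ∧
        ∀ x : ℝ → ℝ, FracSplit.SolvesEquation m a α C x →
          ¬ ∃ y : ℕ → ℝ → ℝ, FracSplit.SolvesSystem m a β y ∧ Set.EqOn x (y 0) (Set.Ici 0) := by
  have hno : ∀ C : ℕ → ℝ, C (m - 1) ≠ 0 → ∀ x : ℝ → ℝ, FracSplit.SolvesEquation m a α C x →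
      ¬ ∃ y : ℕ → ℝ → ℝ, FracSplit.SolvesSystem m a β y ∧ Set.EqOn x (y 0) (Set.Ici 0) := by
    rintro C hC x hx ⟨y, hy, hxy⟩
    refine hC ?_
    rw [← hx.initial (m - 1) (by omega)]
    exact hy.derivN_eq_zero hm hα hα' hβ hβ_first hβ_mid hβ_last
      (hx.admissible m (Finset.mem_Icc.2 (by omega))) hxy
  have hex := fun C => FracSplit.exists_solvesEquation ha hα C
  refine ⟨fun hequiv => ?_, fun C hC => ⟨hex C, hno C hC⟩⟩
  obtain ⟨D, hD⟩ := hequiv fun _ => 1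
  obtain ⟨x, hx⟩ := hex fun _ => 1
  obtain ⟨y, hy, -, hxy⟩ := (hD x).1 hx
  exact hno _ one_ne_zero x hx ⟨y, hy, hxy⟩
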